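/- Let $G$ be a simple, connected, locally finite graph with a countable (finite or infinite) nonempty vertex set $V$ and graph distance $\partial$. Let $(\delta_v)_{v\in V}$ be the canonical orthonormal basis of the complex Hilbert space $\ell^2(V)$. For $k\in\mathbb{N}_0=\{0,1,2,\dots\}$, the distance-$k$ operator $A_k$ is the closure of the linear operator with domain $\operatorname{span}\{\delta_v : v\in V\}$ given by $$\delta_v\longmapsto \sum_{w\,:\,\partial(v,w)=k}\delta_w ,$$ and $A=A_1$ is the adjacency operator. The graph is called distance-regular if there are numbers $a_n,b_n\in\mathbb{N}_0$ $(n\ge 1)$ such that for every $k\in\mathbb{N}_0$ and all vertices $u,v$ with $\partial(u,v)=k$ one has $$\langle A_{k+1}\delta_u,A\delta_v\rangle=b_{k+1},\qquad\text{and, if } k\ge 1,\qquad \langle A_{k-1}\delta_u,A\delta_v\rangle=a_k ;$$ that is, $v$ has exactly $b_{k+1}$ neighbours at distance $k+1$ from $u$ and, if $k\ge1$, exactly $a_k$ neighbours at distance $k-1$ from $u$. The operator $A_k$ is called regular with degree $\deg(A_k)=d_k\in\mathbb{N}_0$ if $\|A_k\delta_v\|^2=d_k$ for every vertex $v$, that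 is, if every vertex has exactly $d_k$ vertices at distance $k$. The isoperimetric constant of $G$ is $$\inf\left\{\frac{|\partial W|}{|W|} : W\subseteq V \text{ finite and nonempty}\right\},$$ where $\partial W$ is the set of edges incident with exactly one vertex of $W$. Suppose that $G$ is distance-regular. Then for every $k\in\mathbb{N}_0$ the operator $A_k$ is bounded and defined on all of $\ell^2(V)$, it is regular, and $$\|A_k\|\le \deg(A_k).$$ Moreover, the isoperimetric constant of $G$ is zero if and only if $\|A_k\|=\deg(A_k)$ for every $k\in\mathbb{N}_0$. -/

import Mathlib

noncomputable section

namespace DistanceGraph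

/-- The complex Hilbert space `ℓ²(V)` of square-summable functions on the vertex set. -/
abbrev ell2 (V : Type*) : Type _ := lp (fun _ : V => ℂ) 2

open Classical in
/-- The canonical basis vector `δ_v` of `ℓ²(V)`. -/
def delta {V : Type*} (v : V) : ell2 V := lp.single 2 v (1 : ℂ)

theorem orthonormal_delta (V : Type*) : Orthonormal ℂ (delta : V → ell2 V) := by
  classical
  rw [orthonormal_iff_ite]
  intro i j
  rw [delta, delta, lp.inner_single_left]
  by_cases h : i = j
  · subst h; simp
  · simp [h]

theorem linearIndependent_delta (V : Type*) : LinearIndependent ℂ (delta : V → ell2 V) :=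
  (orthonormal_delta V).linearIndependent

/-- The vertices at distance `k` from a vertex form a finite set when the graph is connected and
locally finite, so the sum defining `distanceVector` below is a genuine finite sum. -/
theorem finite_sphere {V : Type*} (G : SimpleGraph V) (hconn : G.Connected)
    (hlf : ∀ v, (G.neighborSet v).Finite) (v : V) (k : ℕ) : {w : V | G.dist v w = k}.Finite := by
  induction k with
  | zero =>
    refine (Set.finite_singleton v).subset fun w hw => ?_
    exact ((hconn.dist_eq_zero_iff).1 hw).symm
  | succ k ih =>
    refine (ih.biUnion fun u _ => hlf u).subset fun w hw => ?_
    obtain ⟨p, hp⟩ := hconn.exists_walk_length_eq_dist w v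
    have hw' : G.dist w v = k + 1 := by rw [SimpleGraph.dist_comm]; exact hw
    cases p with
    | nil => simp at hw'
    | @cons _ u _ h q =>
      simp only [Set.mem_iUnion]
      refine ⟨u, ?_, h.symm⟩
      have h1 : q.length = k := by simp at hp; omega
      have h2 : G.dist u v ≤ q.length := SimpleGraph.dist_le q
      have h3 : G.dist w v ≤ G.dist w u + G.dist u v := hconn.dist_triangle
      have h4 : G.dist w u = 1 := SimpleGraph.dist_eq_one_iff_adj.2 h
      change G.dist v u = k
      rw [SimpleGraph.dist_comm]; omega

/-- The vector `A_k δ_v`, the sum of the basis vectors `δ_w` over all vertices `w` at distance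
exactly `k` from `v`. -/
def distanceVector {V : Type*} (G : SimpleGraph V) (k : ℕ) (v : V) : ell2 V :=
  ∑ᶠ w ∈ {w : V | G.dist v w = k}, delta w

/-- The linear operator with domain `span {δ_v}` that sends `δ_v` to the sum of the `δ_w` with `w`
at distance `k` from `v`. -/
def distancePreoperator {V : Type*} (G : SimpleGraph V) (k : ℕ) : ell2 V →ₗ.[ℂ] ell2 V where
  domain := Submodule.span ℂ (Set.range (delta : V → ell2 V))
  toFun := (Finsupp.linearCombination ℂ (distanceVector G k)).comp (linearIndependent_delta V).repr

theorem distancePreoperator_delta {V : Type*} (G : SimpleGraph V) (k : ℕ) (v : V) :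
    distancePreoperator G k ⟨delta v, Submodule.subset_span ⟨v, rfl⟩⟩ = distanceVector G k v := by
  have h := (linearIndependent_delta V).repr_eq_single v
    ⟨delta v, Submodule.subset_span ⟨v, rfl⟩⟩ rfl
  have h' := congrArg (Finsupp.linearCombination ℂ (distanceVector G k)) h
  rw [Finsupp.linearCombination_single, one_smul] at h'
  exact h'

/-- The distance-`k` operator `A_k` of the graph: the closure of `distancePreoperator G k`. The
adjacency operator is `A_1`. -/
def distanceOperator {V : Type*} (G : SimpleGraph V) (k : ℕ) : ell2 V →ₗ.[ℂ] ell2 V :=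
  (distancePreoperator G k).closure

/-- `A_k` is regular of degree `d`: `‖A_k δ_v‖ ^ 2 = d` for every vertex `v`, that is, every vertex
has exactly `d` vertices at distance `k`. -/
def IsRegularAt {V : Type*} (G : SimpleGraph V) (k d : ℕ) : Prop :=
  ∀ v : V, ‖distanceVector G k v‖ ^ 2 = (d : ℝ)

/-- Distance-regularity, with intersection sequence `(a n, b n)` for `n ≥ 1`. For vertices `u, v` at
distance `k`, the inner product `⟪A_{k-1} δ_u, A δ_v⟫` (only for `k ≥ 1`, since `A_{-1} = 0`) is the
number of neighbours of `v` at distance `k - 1` from `u`, and `⟪A_{k+1} δ_u, A δ_v⟫` is the number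
of neighbours of `v` at distance `k + 1` from `u`. In a connected graph the terms `a n`, `b n` are
automatically positive for `1 ≤ n ≤ diameter`. In finite diameter `D` the terms with `n > D` are not
part of the intersection sequence: nothing is asked of them beyond `b (D + 1) = 0`. -/
def IsDistanceRegular {V : Type*} (G : SimpleGraph V) : Prop :=
  ∃ a b : ℕ → ℕ,
    (∀ (k : ℕ) (u v : V), G.dist u v = k + 1 →
      inner ℂ (distanceVector G k u) (distanceVector G 1 v) = (a (k + 1) : ℂ)) ∧
    (∀ (k : ℕ) (u v : V), G.dist u v = k →
      inner ℂ (distanceVector G (k + 1) u) (distanceVector G 1 v) = (b (k + 1) : ℂ))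

/-- The set of edges incident with exactly one vertex of `W`. -/
def edgeBoundary {V : Type*} (G : SimpleGraph V) (W : Set V) : Set (Sym2 V) :=
  {e | e ∈ G.edgeSet ∧ ∃! w : V, w ∈ W ∧ w ∈ e}

/-- The isoperimetric constant: the infimum of `|∂W| / |W|` over all nonempty finite sets `W` of
vertices. -/
def isoperimetricConstant {V : Type*} (G : SimpleGraph V) : ℝ :=
  ⨅ W : {W : Finset V // W.Nonempty},
    ((edgeBoundary G (W.1 : Set V)).ncard : ℝ) / (W.1.card : ℝ)

end DistanceGraph

end

/-!
For a distance-regular graph, counting the edges between consecutive spheres around a vertex shows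
that all spheres of radius `k` have the same size `d_k`, so `A_k` is the operator "sum over the
sphere of radius `k`" of a symmetric `d_k`-regular relation. By the Schur test (Cauchy–Schwarz on
each sphere and an exchange of summation) this operator is bounded by `d_k` on all of `ℓ²(V)`, and
it is the closure of its restriction to the dense span of the basis vectors.

If the isoperimetric constant vanishes, there are finite sets `W` with arbitrarily small
`|∂W| / |W|`. The number of pairs at distance `k` that leave `W` is at most a constant times `|∂W|`,
because a geodesic from inside `W` to outside crosses `∂W`, and only boundedly many geodesic
endpoints belong to a given boundary edge (`exists_sum_card_sphere_sdiff_le`). Hence the Rayleigh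
quotient of `A_k` at the indicator of `W` is close to `d_k`, and `‖A_k‖ = d_k`
(`norm_neighborOperator_sphere_eq`).

Conversely, a positive isoperimetric constant `h` gives Cheeger's inequality. The co-area argument
`isoperimetric_sum_le` extends the isoperimetric inequality from sets to nonnegative finitely
supported functions; applied to `v ↦ |x v| ^ 2`, together with
Cauchy–Schwarz, it yields
`|⟪x, A x⟫| ≤ √(d ^ 2 - h ^ 2 / 4) * ‖x‖ ^ 2` with `d = d_1`. As `A` is symmetric, its norm is the
supremum of its Rayleigh quotients, so `‖A‖ < d` (`norm_neighborOperator_lt`), and equality of norm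
and degree already fails for `k = 1`.
-/

noncomputable section

namespace DistanceGraph

variable {V : Type*}

/-! ### Finitely supported vectors in `ℓ²(V)` -/

theorem dense_span_delta (V : Type*) :
    Dense (Submodule.span ℂ (Set.range (delta : V → ell2 V)) : Set (ell2 V)) := by
  classical
  intro x
  refine mem_closure_of_tendsto (lp.hasSum_single (p := 2) (by norm_num) x)
    (Filter.Eventually.of_forall fun T => Submodule.sum_mem _ fun v _ => ?_)
  have h : lp.single 2 v (x v) = (x v) • (delta v : ell2 V) := by
    rw [delta, ← lp.single_smul, smul_eq_mul, mul_one]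
  exact h ▸ Submodule.smul_mem _ _ (Submodule.subset_span ⟨v, rfl⟩)

theorem inner_delta_left (v : V) (x : ell2 V) : inner ℂ (delta v) x = x v := by
  classical
  rw [delta, lp.inner_single_left]
  simp

theorem sum_norm_sq_le (x : ell2 V) (T : Finset V) : ∑ v ∈ T, ‖x v‖ ^ 2 ≤ ‖x‖ ^ 2 := by
  have h := lp.sum_rpow_le_norm_rpow (p := 2) (by norm_num) x T
  simpa using h

theorem inner_sum_delta (S T : Finset V) [DecidableEq V] :
    inner ℂ (∑ v ∈ S, (delta v : ell2 V)) (∑ v ∈ T, delta v) = ((S ∩ T).card : ℂ) := by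
  simp only [sum_inner, inner_sum, orthonormal_iff_ite.1 (orthonormal_delta V),
    Finset.sum_ite_eq']
  rw [Finset.sum_ite_mem, Finset.inter_comm]
  simp

theorem norm_sum_delta_sq (S : Finset V) :
    ‖∑ v ∈ S, (delta v : ell2 V)‖ ^ 2 = (S.card : ℝ) := by
  classical
  rw [@norm_sq_eq_re_inner ℂ, inner_sum_delta, Finset.inter_self]
  simp

/-! ### Neighbour sums over a regular symmetric relation -/

/-- By symmetry each `w` lies in at most `d` of the sets `S v`. -/
theorem sum_sum_le {S : V → Finset V} {d : ℕ} (hsymm : ∀ v w, w ∈ S v ↔ v ∈ S w)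
    (hcard : ∀ v, (S v).card = d) [DecidableEq V] {φ : V → ℝ} (hφ : ∀ v, 0 ≤ φ v)
    (T : Finset V) :
    ∑ v ∈ T, ∑ w ∈ S v, φ w ≤ d * ∑ w ∈ T.biUnion S, φ w := by
  rw [Finset.sum_comm' (t' := T.biUnion S) (s' := fun w => T.filter fun v => w ∈ S v),
    Finset.mul_sum]
  · refine Finset.sum_le_sum fun w _ => ?_
    rw [Finset.sum_const, nsmul_eq_mul]
    refine mul_le_mul_of_nonneg_right ?_ (hφ w)
    rw [← hcard w]
    exact_mod_cast Finset.card_le_card fun v hv => (hsymm v w).1 (Finset.mem_filter.1 hv).2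
  · intro v w
    simp only [Finset.mem_filter, Finset.mem_biUnion]
    exact ⟨fun h => ⟨h, v, h⟩, fun h => h.1⟩

/-- The Schur test in the form needed here: Cauchy–Schwarz on each neighbour sum, followed by an
exchange of the order of summation. -/
theorem sum_norm_neighborSum_sq_le {S : V → Finset V} {d : ℕ}
    (hsymm : ∀ v w, w ∈ S v ↔ v ∈ S w) (hcard : ∀ v, (S v).card = d) (x : ell2 V)
    (T : Finset V) :
    ∑ v ∈ T, ‖∑ w ∈ S v, x w‖ ^ 2 ≤ (d * ‖x‖) ^ 2 := by
  classical
  have h1 : ∀ v, ‖∑ w ∈ S v, x w‖ ^ 2 ≤ d * ∑ w ∈ S v, ‖x w‖ ^ 2 := fun v =>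
    calc ‖∑ w ∈ S v, x w‖ ^ 2 ≤ (∑ w ∈ S v, ‖x w‖) ^ 2 := by
          gcongr; exact norm_sum_le _ _
      _ ≤ (S v).card * ∑ w ∈ S v, ‖x w‖ ^ 2 := sq_sum_le_card_mul_sum_sq
      _ = d * ∑ w ∈ S v, ‖x w‖ ^ 2 := by rw [hcard]
  calc ∑ v ∈ T, ‖∑ w ∈ S v, x w‖ ^ 2 ≤ ∑ v ∈ T, d * ∑ w ∈ S v, ‖x w‖ ^ 2 :=
        Finset.sum_le_sum fun v _ => h1 v
    _ = d * ∑ v ∈ T, ∑ w ∈ S v, ‖x w‖ ^ 2 := by rw [Finset.mul_sum]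
    _ ≤ d * (d * ∑ w ∈ T.biUnion S, ‖x w‖ ^ 2) := by
        gcongr; exact sum_sum_le hsymm hcard (fun _ => sq_nonneg _) T
    _ ≤ d * (d * ‖x‖ ^ 2) := by gcongr; exact sum_norm_sq_le x _
    _ = (d * ‖x‖) ^ 2 := by ring

/-- The bounded operator `x ↦ (v ↦ ∑ w ∈ S v, x w)` on `ℓ²(V)` attached to a symmetric relation,
given by its finite fibres `S v`, all of which have `d` elements. -/
def neighborOperator (S : V → Finset V) (d : ℕ) (hsymm : ∀ v w, w ∈ S v ↔ v ∈ S w)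
    (hcard : ∀ v, (S v).card = d) : ell2 V →L[ℂ] ell2 V :=
  LinearMap.mkContinuous
    { toFun := fun x => ⟨fun v => ∑ w ∈ S v, x w, memℓp_gen' (C := (d * ‖x‖) ^ 2) fun T => by
        simpa using sum_norm_neighborSum_sq_le hsymm hcard x T⟩
      map_add' := fun x y => by
        ext v
        exact Finset.sum_add_distrib
      map_smul' := fun c x => by
        ext v
        exact (Finset.mul_sum _ _ _).symm }
    d fun x => lp.norm_le_of_forall_sum_le (by norm_num) (by positivity) fun T => by
      simpa using sum_norm_neighborSum_sq_le hsymm hcard x T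

section

variable {S : V → Finset V} {d : ℕ} (hsymm : ∀ v w, w ∈ S v ↔ v ∈ S w)
  (hcard : ∀ v, (S v).card = d)

theorem neighborOperator_apply (x : ell2 V) (v : V) :
    neighborOperator S d hsymm hcard x v = ∑ w ∈ S v, x w := rfl

theorem norm_neighborOperator_le : ‖neighborOperator S d hsymm hcard‖ ≤ d :=
  LinearMap.mkContinuous_norm_le _ (by positivity) _

theorem neighborOperator_delta (v : V) :
    neighborOperator S d hsymm hcard (delta v) = ∑ w ∈ S v, delta w := by
  classical
  ext u
  rw [neighborOperator_apply, ← inner_delta_left u, inner_sum]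
  simp only [← inner_delta_left, orthonormal_iff_ite.1 (orthonormal_delta V),
    Finset.sum_ite_eq', Finset.sum_ite_eq, hsymm u v]

theorem isSymmetric_neighborOperator :
    (neighborOperator S d hsymm hcard : ell2 V →ₗ[ℂ] ell2 V).IsSymmetric := by
  have h : ContinuousLinearMap.adjoint (neighborOperator S d hsymm hcard) =
      neighborOperator S d hsymm hcard := by
    refine ContinuousLinearMap.ext_on (dense_span_delta V) ?_
    rintro _ ⟨v, rfl⟩
    ext u
    rw [← inner_delta_left u, ContinuousLinearMap.adjoint_inner_right, neighborOperator_delta,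
      sum_inner, neighborOperator_apply]
    exact Finset.sum_congr rfl fun w _ => inner_delta_left w _
  exact (ContinuousLinearMap.isSelfAdjoint_iff_isSymmetric.1 h)

/-- On a vector whose coordinates outside `T` vanish, the quadratic form of a neighbour operator is
at most the same form evaluated on absolute values. -/
theorem norm_inner_neighborOperator_le {x : ell2 V} {T : Finset V} (hx : ∀ v ∉ T, x v = 0) :
    ‖inner ℂ x (neighborOperator S d hsymm hcard x)‖ ≤
      ∑ v ∈ T, ∑ w ∈ S v, ‖x v‖ * ‖x w‖ := by
  rw [lp.inner_eq_tsum, tsum_eq_sum (s := T) fun v hv => by rw [hx v hv, inner_zero_left]]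
  refine (norm_sum_le _ _).trans (Finset.sum_le_sum fun v _ => ?_)
  refine (norm_inner_le_norm _ _).trans ?_
  rw [neighborOperator_apply, ← Finset.mul_sum]
  gcongr
  exact norm_sum_le _ _

theorem inner_sum_delta_neighborOperator (W : Finset V) [DecidableEq V] :
    inner ℂ (∑ v ∈ W, delta v) (neighborOperator S d hsymm hcard (∑ v ∈ W, delta v)) =
      ((∑ v ∈ W, (S v ∩ W).card : ℕ) : ℂ) := by
  rw [map_sum, inner_sum]
  simp only [neighborOperator_delta, inner_sum_delta, Finset.inter_comm W]
  push_cast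
  rfl

end

/-- A quadratic-form bound for a symmetric operator that holds on the finitely supported vectors
bounds its norm. -/
theorem norm_le_of_norm_inner_le {A : ell2 V →L[ℂ] ell2 V}
    (hA : (A : ell2 V →ₗ[ℂ] ell2 V).IsSymmetric) {q : ℝ} (hq : 0 ≤ q)
    (h : ∀ (T : Finset V) (x : ell2 V), (∀ v ∉ T, x v = 0) →
      ‖inner ℂ x (A x)‖ ≤ q * ‖x‖ ^ 2) : ‖A‖ ≤ q := by
  classical
  have h' : ∀ x, ‖inner ℂ x (A x)‖ ≤ q * ‖x‖ ^ 2 := by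
    intro x
    have hx : Filter.Tendsto (fun T : Finset V => ∑ v ∈ T, lp.single 2 v (x v)) Filter.atTop
        (nhds x) := lp.hasSum_single (p := 2) (by norm_num) x
    have hc1 : Continuous fun y : ell2 V => ‖inner ℂ y (A y)‖ := by fun_prop
    have hc2 : Continuous fun y : ell2 V => q * ‖y‖ ^ 2 := by fun_prop
    refine le_of_tendsto_of_tendsto' ((hc1.tendsto x).comp hx) ((hc2.tendsto x).comp hx)
      fun T => h T _ fun v hv => ?_
    rw [lp.coeFn_sum, Finset.sum_apply]
    refine Finset.sum_eq_zero fun w hw => lp.single_apply_ne _ _ _ ?_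
    rintro rfl
    exact hv hw
  rw [A.norm_eq_iSup_rayleighQuotient hA]
  refine ciSup_le fun x => ?_
  rw [ContinuousLinearMap.rayleighQuotient, abs_div, abs_of_nonneg (sq_nonneg ‖x‖)]
  refine div_le_of_le_mul₀ (sq_nonneg _) hq ?_
  rw [ContinuousLinearMap.reApplyInnerSelf_apply]
  refine (RCLike.abs_re_le_norm _).trans ?_
  rw [norm_inner_symm]
  exact h' x

/-! ### The closure of a densely defined restriction -/

/-- The closure of the restriction of a bounded operator to a dense domain is the operator. -/
theorem closure_eq_toPMap_top {E F : Type*} [NormedAddCommGroup E] [NormedSpace ℂ E]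
    [NormedAddCommGroup F] [NormedSpace ℂ F] {f : E →ₗ.[ℂ] F} {A : E →L[ℂ] F}
    (hf : Dense (f.domain : Set E)) (h : ∀ x : f.domain, f x = A x) :
    f.closure = A.toLinearMap.toPMap ⊤ := by
  have hmem : ∀ p : E × F, p ∈ (A.toLinearMap.toPMap ⊤).graph ↔ p.2 = A p.1 := by
    intro p
    rw [LinearPMap.mem_graph_iff]
    constructor
    · rintro ⟨y, hy, hy'⟩
      rw [← hy', ← hy]
      rfl
    · intro hp
      exact ⟨⟨p.1, trivial⟩, rfl, hp.symm⟩
  have hclosed : (A.toLinearMap.toPMap ⊤).IsClosed := by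
    have : ((A.toLinearMap.toPMap ⊤).graph : Set (E × F)) = {p | p.2 = A p.1} := Set.ext hmem
    rw [LinearPMap.IsClosed, this]
    exact isClosed_eq continuous_snd (A.continuous.comp continuous_fst)
  have hle : f ≤ A.toLinearMap.toPMap ⊤ :=
    ⟨le_top, fun x y hxy => (h x).trans (by rw [hxy]; rfl)⟩
  have hcl := hclosed.isClosable.leIsClosable hle
  refine LinearPMap.eq_of_eq_graph ?_
  rw [← hcl.graph_closure_eq_closure_graph]
  refine le_antisymm ?_ ?_
  · exact Submodule.topologicalClosure_minimal _ (LinearPMap.le_graph_of_le hle) hclosed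
  · rintro ⟨x, y⟩ hxy
    obtain rfl : y = A x := (hmem _).1 hxy
    have hc : Continuous fun z : E => (z, A z) := by fun_prop
    refine closure_mono ?_ (image_closure_subset_closure_image hc ⟨x, hf x, rfl⟩)
    rintro _ ⟨z, hz, rfl⟩
    exact LinearPMap.mem_graph_iff _ |>.2 ⟨⟨z, hz⟩, rfl, h _⟩

/-! ### A Cheeger inequality for a regular symmetric relation -/

/-- The co-area inequality: an isoperimetric inequality for finite sets gives one for finitely
supported nonnegative functions, on subtracting the indicator of the support, times the minimum of
the function over the support, again and again. -/
theorem isoperimetric_sum_le {S : V → Finset V} [DecidableEq V] {h : ℝ}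
    (hS : ∀ W : Finset V, h * W.card ≤ ∑ v ∈ W, ((S v \ W).card : ℝ)) (T : Finset V) :
    ∀ g : V → ℝ, (∀ v, 0 ≤ g v) → (∀ v ∉ T, g v = 0) →
      h * ∑ v ∈ T, g v ≤ ∑ v ∈ T, ∑ w ∈ S v, max (g v - g w) 0 := by
  induction T using Finset.strongInduction with
  | H T ih =>
    intro g hg hgT
    rcases T.eq_empty_or_nonempty with rfl | hT
    · simp
    obtain ⟨t, ht, hmin⟩ := T.exists_min_image g hT
    set m := g t with hm
    let g' : V → ℝ := fun v => if v ∈ T then g v - m else 0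
    have hg'T : ∀ v ∈ T, g' v = g v - m := fun v hv => if_pos hv
    have hg'n : ∀ v ∉ T, g' v = 0 := fun v hv => if_neg hv
    have hg't : g' t = 0 := by rw [hg'T t ht, hm, sub_self]
    have hg'0 : ∀ v, 0 ≤ g' v := fun v => by
      by_cases hv : v ∈ T
      · rw [hg'T v hv]; exact sub_nonneg.2 (hmin v hv)
      · rw [hg'n v hv]
    have key := ih (T.erase t) (Finset.erase_ssubset ht) g' hg'0 fun v hv => by
      by_cases hvt : v = t
      · rw [hvt, hg't]
      · exact hg'n v fun hvT => hv (Finset.mem_erase.2 ⟨hvt, hvT⟩)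
    rw [Finset.sum_erase T hg't] at key
    have key' : h * ∑ v ∈ T, g' v ≤ ∑ v ∈ T, ∑ w ∈ S v, max (g' v - g' w) 0 :=
      key.trans (Finset.sum_le_sum_of_subset_of_nonneg (Finset.erase_subset _ _)
        fun v _ _ => Finset.sum_nonneg fun w _ => le_max_right _ _)
    have hsum : ∑ v ∈ T, g v = ∑ v ∈ T, g' v + m * T.card := by
      rw [Finset.sum_congr rfl hg'T, Finset.sum_sub_distrib, Finset.sum_const, nsmul_eq_mul]
      ring
    have hpt : ∀ v ∈ T, ∑ w ∈ S v, max (g v - g w) 0 =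
        ∑ w ∈ S v, max (g' v - g' w) 0 + m * (S v \ T).card := by
      intro v hv
      have : m * ((S v \ T).card : ℝ) = ∑ w ∈ S v, if w ∉ T then m else 0 := by
        rw [← Finset.sum_filter, Finset.sum_const, nsmul_eq_mul, Finset.sdiff_eq_filter, mul_comm]
      rw [this, ← Finset.sum_add_distrib]
      refine Finset.sum_congr rfl fun w _ => ?_
      by_cases hw : w ∈ T
      · rw [if_neg (not_not.2 hw), hg'T v hv, hg'T w hw, add_zero, sub_sub_sub_cancel_right]
      · rw [if_pos hw, hg'n w hw, hgT w hw, hg'T v hv, sub_zero, sub_zero,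
          max_eq_left (hg v), max_eq_left (sub_nonneg.2 (hmin v hv)), sub_add_cancel]
    have hm0 : 0 ≤ m := hg t
    have hSm := mul_le_mul_of_nonneg_left (hS T) hm0
    rw [hsum, Finset.sum_congr rfl hpt, Finset.sum_add_distrib, ← Finset.mul_sum]
    linarith

/-- The quadratic form of Cheeger's inequality. The co-area inequality is applied to `f ^ 2`, and
Cauchy–Schwarz splits `|f v ^ 2 - f w ^ 2|` into the factors `|f v - f w|` and `f v + f w`. With
`N = ∑ f v ^ 2` and `Q = ∑ ∑ f v * f w` the square sums of the factors are bounded by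
`2 * (d * N - Q)` and `2 * (d * N + Q)`. -/
theorem cheeger_quadratic {S : V → Finset V} {d : ℕ} (hsymm : ∀ v w, w ∈ S v ↔ v ∈ S w)
    (hcard : ∀ v, (S v).card = d) [DecidableEq V] {h : ℝ} (hh : 0 ≤ h)
    (hS : ∀ W : Finset V, h * W.card ≤ ∑ v ∈ W, ((S v \ W).card : ℝ)) {T : Finset V}
    {f : V → ℝ} (hf : ∀ v, 0 ≤ f v) (hfT : ∀ v ∉ T, f v = 0) :
    (∑ v ∈ T, ∑ w ∈ S v, f v * f w) ^ 2 ≤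
      ((d : ℝ) ^ 2 - h ^ 2 / 4) * (∑ v ∈ T, f v ^ 2) ^ 2 := by
  set N := ∑ v ∈ T, f v ^ 2 with hN
  set Q := ∑ v ∈ T, ∑ w ∈ S v, f v * f w with hQ
  have hN0 : 0 ≤ N := Finset.sum_nonneg fun v _ => sq_nonneg _
  have h1 : h * N ≤ ∑ v ∈ T, ∑ w ∈ S v, |f v - f w| * (f v + f w) := by
    refine (isoperimetric_sum_le hS T (fun v => f v ^ 2) (fun v => sq_nonneg _)
      fun v hv => by simp [hfT v hv]).trans ?_
    refine Finset.sum_le_sum fun v _ => Finset.sum_le_sum fun w _ => ?_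
    have hs : 0 ≤ f v + f w := add_nonneg (hf v) (hf w)
    refine max_le ?_ (mul_nonneg (abs_nonneg _) hs)
    rw [show f v ^ 2 - f w ^ 2 = (f v - f w) * (f v + f w) by ring]
    exact mul_le_mul_of_nonneg_right (le_abs_self _) hs
  have h2 : (∑ v ∈ T, ∑ w ∈ S v, |f v - f w| * (f v + f w)) ^ 2 ≤
      (∑ v ∈ T, ∑ w ∈ S v, (f v - f w) ^ 2) * ∑ v ∈ T, ∑ w ∈ S v, (f v + f w) ^ 2 := by
    have := Finset.sum_mul_sq_le_sq_mul_sq (T.sigma S) (fun p => |f p.1 - f p.2|)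
      (fun p => f p.1 + f p.2)
    simpa only [Finset.sum_sigma, sq_abs] using this
  have h3 : ∑ v ∈ T, ∑ _w ∈ S v, f v ^ 2 = d * N := by
    simp only [Finset.sum_const, hcard, nsmul_eq_mul, ← Finset.mul_sum, hN]
  have h4 : ∑ v ∈ T, ∑ w ∈ S v, f w ^ 2 ≤ d * N := by
    refine (sum_sum_le hsymm hcard (fun v => sq_nonneg (f v)) T).trans ?_
    gcongr
    rw [hN, Finset.sum_subset (Finset.subset_union_right (s₁ := T.biUnion S) (s₂ := T))
      fun v _ hv => by rw [hfT v hv, zero_pow two_ne_zero]]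
    exact Finset.sum_le_sum_of_subset_of_nonneg Finset.subset_union_left
      fun v _ _ => sq_nonneg _
  have h5 : ∑ v ∈ T, ∑ w ∈ S v, (f v - f w) ^ 2 ≤ 2 * (d * N - Q) := by
    have : ∑ v ∈ T, ∑ w ∈ S v, (f v - f w) ^ 2 =
        ∑ v ∈ T, ∑ _w ∈ S v, f v ^ 2 + ∑ v ∈ T, ∑ w ∈ S v, f w ^ 2 - 2 * Q := by
      simp only [hQ, Finset.mul_sum, ← Finset.sum_add_distrib, ← Finset.sum_sub_distrib]
      exact Finset.sum_congr rfl fun v _ => Finset.sum_congr rfl fun w _ => by ring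
    linarith
  have h6 : ∑ v ∈ T, ∑ w ∈ S v, (f v + f w) ^ 2 ≤ 2 * (d * N + Q) := by
    have : ∑ v ∈ T, ∑ w ∈ S v, (f v + f w) ^ 2 =
        ∑ v ∈ T, ∑ _w ∈ S v, f v ^ 2 + ∑ v ∈ T, ∑ w ∈ S v, f w ^ 2 + 2 * Q := by
      simp only [hQ, Finset.mul_sum, ← Finset.sum_add_distrib]
      exact Finset.sum_congr rfl fun v _ => Finset.sum_congr rfl fun w _ => by ring
    linarith
  have h7 : 0 ≤ ∑ v ∈ T, ∑ w ∈ S v, (f v - f w) ^ 2 :=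
    Finset.sum_nonneg fun v _ => Finset.sum_nonneg fun w _ => sq_nonneg _
  have h8 : 0 ≤ ∑ v ∈ T, ∑ w ∈ S v, (f v + f w) ^ 2 :=
    Finset.sum_nonneg fun v _ => Finset.sum_nonneg fun w _ => sq_nonneg _
  have h9 : (h * N) ^ 2 ≤ (2 * (d * N - Q)) * (2 * (d * N + Q)) :=
    (pow_le_pow_left₀ (mul_nonneg hh hN0) h1 2).trans
      (h2.trans (mul_le_mul h5 h6 h8 (h7.trans h5)))
  linarith

/-- A positive isoperimetric bound forces the norm of the neighbour operator strictly below the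
degree. -/
theorem norm_neighborOperator_lt [Nonempty V] {S : V → Finset V} {d : ℕ}
    (hsymm : ∀ v w, w ∈ S v ↔ v ∈ S w) (hcard : ∀ v, (S v).card = d) [DecidableEq V] {h : ℝ}
    (hh : 0 < h) (hS : ∀ W : Finset V, h * W.card ≤ ∑ v ∈ W, ((S v \ W).card : ℝ)) :
    ‖neighborOperator S d hsymm hcard‖ < d := by
  -- A single vertex has at most `d` boundary pairs, so `h ≤ d` and the square root is no junk.
  have hd : h ≤ d := by
    obtain ⟨v⟩ := ‹Nonempty V›
    have h1 := hS {v}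
    rw [Finset.card_singleton, Finset.sum_singleton, Nat.cast_one, mul_one] at h1
    refine h1.trans ?_
    rw [← hcard v]
    exact_mod_cast Finset.card_le_card Finset.sdiff_subset
  have hq : 0 ≤ (d : ℝ) ^ 2 - h ^ 2 / 4 := by nlinarith
  have hlt : √((d : ℝ) ^ 2 - h ^ 2 / 4) < d := by
    rw [Real.sqrt_lt' (hh.trans_le hd)]
    nlinarith
  refine lt_of_le_of_lt ?_ hlt
  refine norm_le_of_norm_inner_le (isSymmetric_neighborOperator hsymm hcard) (Real.sqrt_nonneg _)
    fun T x hx => (norm_inner_neighborOperator_le hsymm hcard hx).trans ?_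
  have hc := cheeger_quadratic hsymm hcard hh.le hS (T := T) (f := fun v => ‖x v‖)
    (fun v => norm_nonneg _) (fun v hv => by simp [hx v hv])
  refine (Real.le_sqrt_of_sq_le hc).trans ?_
  rw [Real.sqrt_mul hq, Real.sqrt_sq (Finset.sum_nonneg fun v _ => sq_nonneg _)]
  gcongr
  exact sum_norm_sq_le x T

/-- The Rayleigh quotient at the indicator of `W` is a lower bound for the norm. -/
theorem mul_card_le_norm_neighborOperator {S : V → Finset V} {d : ℕ}
    (hsymm : ∀ v w, w ∈ S v ↔ v ∈ S w) (hcard : ∀ v, (S v).card = d) [DecidableEq V]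
    (W : Finset V) :
    (d : ℝ) * W.card - ∑ v ∈ W, ((S v \ W).card : ℝ) ≤
      ‖neighborOperator S d hsymm hcard‖ * W.card := by
  have h1 : (d : ℝ) * W.card - ∑ v ∈ W, ((S v \ W).card : ℝ) =
      ((∑ v ∈ W, (S v ∩ W).card : ℕ) : ℝ) := by
    have : ∀ v ∈ W, ((S v ∩ W).card : ℝ) = d - (S v \ W).card := fun v _ => by
      rw [eq_sub_iff_add_eq, ← hcard v]
      exact_mod_cast Finset.card_inter_add_card_sdiff (S v) W
    push_cast
    rw [Finset.sum_congr rfl this, Finset.sum_sub_distrib, Finset.sum_const, nsmul_eq_mul]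
    ring
  have h2 := norm_inner_le_norm (𝕜 := ℂ) (∑ v ∈ W, (delta v : ell2 V))
    (neighborOperator S d hsymm hcard (∑ v ∈ W, delta v))
  rw [inner_sum_delta_neighborOperator, Complex.norm_natCast] at h2
  rw [h1, ← norm_sum_delta_sq]
  refine h2.trans ?_
  have h3 := (neighborOperator S d hsymm hcard).le_opNorm (∑ v ∈ W, (delta v : ell2 V))
  calc _ ≤ ‖∑ v ∈ W, (delta v : ell2 V)‖ *
        (‖neighborOperator S d hsymm hcard‖ * ‖∑ v ∈ W, (delta v : ell2 V)‖) := by gcongr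
    _ = _ := by ring

/-! ### Spheres in a connected locally finite graph -/

/-- A geodesic from `u` to `v` passes through a neighbour of `v` that is one step closer to `u`. -/
theorem exists_dist_eq_of_dist_eq_add_one {G : SimpleGraph V}
    (hconn : G.Connected) {k : ℕ} {u v : V} (h : G.dist u v = k + 1) :
    ∃ w, G.dist u w = k ∧ G.dist w v = 1 := by
  obtain ⟨p, hp⟩ := hconn.exists_walk_length_eq_dist v u
  rw [SimpleGraph.dist_comm, h] at hp
  cases p with
  | nil => simp at hp
  | @cons _ w _ hvw q =>
    have h1 : q.length = k := by simpa using hp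
    have h2 : G.dist w u ≤ q.length := SimpleGraph.dist_le q
    have h3 : G.dist u v ≤ G.dist u w + G.dist w v := hconn.dist_triangle
    have h4 : G.dist w v = 1 := SimpleGraph.dist_eq_one_iff_adj.2 hvw.symm
    rw [SimpleGraph.dist_comm] at h2
    exact ⟨w, by omega, h4⟩

section

variable (G : SimpleGraph V) (hconn : G.Connected) (hlf : ∀ v, (G.neighborSet v).Finite)

/-- The vertices at distance exactly `k` from `v`, as a finite set. -/
def sphere (k : ℕ) (v : V) : Finset V := (finite_sphere G hconn hlf v k).toFinset

theorem mem_sphere {k : ℕ} {v w : V} : w ∈ sphere G hconn hlf k v ↔ G.dist v w = k := by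
  simp [sphere]

theorem mem_sphere_comm (k : ℕ) (v w : V) :
    w ∈ sphere G hconn hlf k v ↔ v ∈ sphere G hconn hlf k w := by
  rw [mem_sphere, mem_sphere, SimpleGraph.dist_comm]

theorem distanceVector_eq_sum (k : ℕ) (v : V) :
    distanceVector G k v = ∑ w ∈ sphere G hconn hlf k v, delta w :=
  finsum_mem_eq_finite_toFinset_sum _ _

theorem inner_distanceVector [DecidableEq V] (k l : ℕ) (u v : V) :
    inner ℂ (distanceVector G k u) (distanceVector G l v) =
      ((sphere G hconn hlf k u ∩ sphere G hconn hlf l v).card : ℂ) := by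
  rw [distanceVector_eq_sum G hconn hlf, distanceVector_eq_sum G hconn hlf, inner_sum_delta]

theorem distanceOperator_eq {k d : ℕ} (hd : ∀ v, (sphere G hconn hlf k v).card = d) :
    distanceOperator G k =
      (neighborOperator (sphere G hconn hlf k) d (mem_sphere_comm G hconn hlf k)
        hd).toLinearMap.toPMap ⊤ := by
  refine closure_eq_toPMap_top (dense_span_delta V) ?_
  suffices h : (distancePreoperator G k).toFun =
      (neighborOperator (sphere G hconn hlf k) d (mem_sphere_comm G hconn hlf k)
        hd).toLinearMap.comp
        (distancePreoperator G k).domain.subtype from fun x => LinearMap.congr_fun h x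
  refine LinearMap.ext_on (s := Subtype.val ⁻¹' Set.range (delta : V → ell2 V))
    Submodule.span_span_coe_preimage ?_
  rintro ⟨_, _⟩ ⟨v, rfl⟩
  exact (distancePreoperator_delta G k v).trans ((distanceVector_eq_sum G hconn hlf k v).trans
    (neighborOperator_delta (mem_sphere_comm G hconn hlf k) hd v).symm)

/-! ### Degrees of the distance operators -/

/-- Counting the edges between the spheres of radii `k` and `k + 1` around a vertex determines the
size of the second sphere from that of the first. -/
theorem exists_card_sphere (hdr : IsDistanceRegular G) (k : ℕ) :
    ∃ d, ∀ v, (sphere G hconn hlf k v).card = d := by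
  classical
  obtain ⟨a, b, ha, hb⟩ := hdr
  induction k with
  | zero =>
    refine ⟨1, fun v => Finset.card_eq_one.2 ⟨v, ?_⟩⟩
    ext w
    rw [mem_sphere, Finset.mem_singleton, hconn.dist_eq_zero_iff, eq_comm]
  | succ k ih =>
    obtain ⟨d, hd⟩ := ih
    have ha' : ∀ u v, v ∈ sphere G hconn hlf (k + 1) u →
        (sphere G hconn hlf k u ∩ sphere G hconn hlf 1 v).card = a (k + 1) := fun u v huv => by
      have := ha k u v ((mem_sphere G hconn hlf).1 huv)
      rw [inner_distanceVector G hconn hlf] at this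
      exact_mod_cast this
    have hb' : ∀ u v, v ∈ sphere G hconn hlf k u →
        (sphere G hconn hlf (k + 1) u ∩ sphere G hconn hlf 1 v).card = b (k + 1) :=
      fun u v huv => by
        have := hb k u v ((mem_sphere G hconn hlf).1 huv)
        rw [inner_distanceVector G hconn hlf] at this
        exact_mod_cast this
    have hcount : ∀ u, (sphere G hconn hlf (k + 1) u).card * a (k + 1) = d * b (k + 1) := by
      intro u
      have h := Finset.sum_card_bipartiteAbove_eq_sum_card_bipartiteBelow
        (s := sphere G hconn hlf (k + 1) u) (t := sphere G hconn hlf k u)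
        (fun v w => G.dist v w = 1)
      rw [Finset.sum_congr rfl fun v hv => ?_, Finset.sum_const, smul_eq_mul,
        Finset.sum_congr rfl fun w hw => ?_, Finset.sum_const, smul_eq_mul, hd] at h
      · exact h
      · rw [← hb' u w hw]
        congr 1
        ext v
        rw [Finset.mem_bipartiteBelow, Finset.mem_inter, mem_sphere G hconn hlf (k := 1),
          SimpleGraph.dist_comm (u := v)]
      · rw [← ha' u v hv]
        congr 1
        ext w
        rw [Finset.mem_bipartiteAbove, Finset.mem_inter, mem_sphere G hconn hlf (k := 1)]
    rcases Nat.eq_zero_or_pos (a (k + 1)) with h0 | h0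
    -- No vertex is at distance `k + 1` from another: it would have a neighbour at distance `k`.
    · refine ⟨0, fun u => Finset.card_eq_zero.2 (Finset.eq_empty_of_forall_notMem fun v hv => ?_)⟩
      obtain ⟨w, hw, hwv⟩ := exists_dist_eq_of_dist_eq_add_one hconn
        ((mem_sphere G hconn hlf).1 hv)
      have := ha' u v hv
      rw [h0, Finset.card_eq_zero] at this
      refine Finset.notMem_empty w (this ▸ Finset.mem_inter.2 ⟨?_, ?_⟩)
      · rwa [mem_sphere]
      · rwa [mem_sphere, SimpleGraph.dist_comm]
    · exact ⟨d * b (k + 1) / a (k + 1), fun u => by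
        rw [← hcount u, Nat.mul_div_cancel _ h0]⟩

/-! ### Boundaries of finite sets -/

/-- Pairs at distance `k + 1` that leave `W` are counted through an intermediate vertex of a
geodesic: either the first `k` steps leave `W`, or the last step does. -/
theorem sum_card_sphere_sdiff_succ_le [DecidableEq V] {k d e : ℕ}
    (hd : ∀ v, (sphere G hconn hlf k v).card = d) (he : ∀ v, (sphere G hconn hlf 1 v).card = e)
    (W : Finset V) :
    ∑ v ∈ W, (sphere G hconn hlf (k + 1) v \ W).card ≤
      (∑ v ∈ W, (sphere G hconn hlf k v \ W).card) * e +
        (∑ v ∈ W, (sphere G hconn hlf 1 v \ W).card) * d := by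
  let C : ℕ → Finset (Σ _ : V, V) := fun j => W.sigma fun v => sphere G hconn hlf j v \ W
  have hC : ∀ j, ∑ v ∈ W, (sphere G hconn hlf j v \ W).card = (C j).card := fun j =>
    (Finset.card_sigma _ _).symm
  have hmem : ∀ j u v, (⟨u, v⟩ : Σ _ : V, V) ∈ C j ↔ u ∈ W ∧ G.dist u v = j ∧ v ∉ W := by
    intro j u v
    rw [Finset.mem_sigma, Finset.mem_sdiff, mem_sphere]
  have hsub : C (k + 1) ⊆
      (C k).biUnion (fun p => (sphere G hconn hlf 1 p.2).image fun v => ⟨p.1, v⟩) ∪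
        (C 1).biUnion (fun p => (sphere G hconn hlf k p.1).image fun u => ⟨u, p.2⟩) := by
    rintro ⟨u, v⟩ huv
    obtain ⟨hu, hd, hv⟩ := (hmem _ _ _).1 huv
    obtain ⟨w, hw, hwv⟩ := exists_dist_eq_of_dist_eq_add_one hconn hd
    simp only [Finset.mem_union, Finset.mem_biUnion, Finset.mem_image]
    by_cases hwW : w ∈ W
    · exact Or.inr ⟨⟨w, v⟩, (hmem _ _ _).2 ⟨hwW, hwv, hv⟩, u,
        (mem_sphere_comm G hconn hlf k u w).1 ((mem_sphere G hconn hlf).2 hw), rfl⟩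
    · exact Or.inl ⟨⟨u, w⟩, (hmem _ _ _).2 ⟨hu, hw, hwW⟩, v, (mem_sphere G hconn hlf).2 hwv, rfl⟩
  rw [hC, hC, hC]
  refine (Finset.card_le_card hsub).trans ((Finset.card_union_le _ _).trans (add_le_add ?_ ?_))
  · exact Finset.card_biUnion_le_card_mul _ _ _ fun p _ => Finset.card_image_le.trans (he _).le
  · exact Finset.card_biUnion_le_card_mul _ _ _ fun p _ => Finset.card_image_le.trans (hd _).le

/-- The number of pairs at distance `k` leaving a finite set is at most a constant multiple of the
number of boundary edges. -/
theorem exists_sum_card_sphere_sdiff_le [DecidableEq V]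
    (hd : ∀ k, ∃ d, ∀ v, (sphere G hconn hlf k v).card = d) (k : ℕ) :
    ∃ C : ℕ, ∀ W : Finset V, ∑ v ∈ W, (sphere G hconn hlf k v \ W).card ≤
      C * ∑ v ∈ W, (sphere G hconn hlf 1 v \ W).card := by
  induction k with
  | zero =>
    refine ⟨0, fun W => ?_⟩
    rw [zero_mul, Nat.le_zero]
    refine Finset.sum_eq_zero fun v hv => Finset.card_eq_zero.2 (Finset.sdiff_eq_empty_iff_subset.2
      fun w hw => ?_)
    rwa [← (hconn.dist_eq_zero_iff).1 ((mem_sphere G hconn hlf).1 hw)]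
  | succ k ih =>
    obtain ⟨C, hC⟩ := ih
    obtain ⟨d, hdk⟩ := hd k
    obtain ⟨e, he⟩ := hd 1
    refine ⟨C * e + d, fun W => ?_⟩
    refine (sum_card_sphere_sdiff_succ_le G hconn hlf hdk he W).trans ?_
    calc _ ≤ (C * ∑ v ∈ W, (sphere G hconn hlf 1 v \ W).card) * e +
        (∑ v ∈ W, (sphere G hconn hlf 1 v \ W).card) * d := by gcongr; exact hC W
      _ = _ := by ring

theorem ncard_edgeBoundary [DecidableEq V] (W : Finset V) :
    (edgeBoundary G (W : Set V)).ncard = ∑ v ∈ W, (sphere G hconn hlf 1 v \ W).card := by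
  let C : Finset (Σ _ : V, V) := W.sigma fun v => sphere G hconn hlf 1 v \ W
  have hmem : ∀ u v, (⟨u, v⟩ : Σ _ : V, V) ∈ C ↔ u ∈ W ∧ G.Adj u v ∧ v ∉ W := by
    intro u v
    rw [Finset.mem_sigma, Finset.mem_sdiff, mem_sphere, SimpleGraph.dist_eq_one_iff_adj]
  have himage : edgeBoundary G (W : Set V) =
      (fun p : Σ _ : V, V => s(p.1, p.2)) '' (C : Set _) := by
    ext e
    constructor
    · rintro ⟨he, u, ⟨huW, hue⟩, huniq⟩
      obtain ⟨v, rfl⟩ := Sym2.mem_iff_exists.1 hue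
      have huv : G.Adj u v := he
      refine ⟨⟨u, v⟩, (hmem u v).2 ⟨huW, huv, fun hv => ?_⟩, rfl⟩
      exact huv.ne (huniq v ⟨hv, Sym2.mem_mk_right u v⟩).symm
    · rintro ⟨⟨u, v⟩, huv, rfl⟩
      obtain ⟨hu, hadj, hv⟩ := (hmem u v).1 huv
      refine ⟨hadj, u, ⟨hu, Sym2.mem_mk_left u v⟩, ?_⟩
      rintro w ⟨hw, hwe⟩
      rcases Sym2.mem_iff.1 hwe with rfl | rfl
      · rfl
      · exact absurd hw hv
  have hinj : Set.InjOn (fun p : Σ _ : V, V => s(p.1, p.2)) (C : Set _) := by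
    rintro ⟨u, v⟩ huv ⟨u', v'⟩ huv' h
    obtain ⟨hu, -, hv⟩ := (hmem u v).1 huv
    obtain ⟨hu', -, hv'⟩ := (hmem u' v').1 huv'
    rcases Sym2.eq_iff.1 h with ⟨h1, h2⟩ | ⟨h1, h2⟩
    · dsimp only at h1 h2
      rw [h1, h2]
    · dsimp only at h1 h2
      exact absurd (h1 ▸ hu) hv'
  rw [himage, hinj.ncard_image, Set.ncard_coe_finset, Finset.card_sigma]

theorem isoperimetricConstant_nonneg : 0 ≤ isoperimetricConstant G :=
  Real.iInf_nonneg fun _ => by positivity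

theorem isoperimetricConstant_mul_card_le (W : Finset V) :
    isoperimetricConstant G * W.card ≤ ((edgeBoundary G (W : Set V)).ncard : ℝ) := by
  rcases W.eq_empty_or_nonempty with rfl | hW
  · simp
  rw [← le_div_iff₀ (by exact_mod_cast hW.card_pos)]
  exact ciInf_le (f := fun W : {W : Finset V // W.Nonempty} =>
    ((edgeBoundary G (W.1 : Set V)).ncard : ℝ) / (W.1.card : ℝ))
    ⟨0, by rintro _ ⟨_, rfl⟩; positivity⟩ ⟨W, hW⟩

theorem exists_ncard_edgeBoundary_lt [Nonempty V] (h : isoperimetricConstant G = 0) {ε : ℝ}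
    (hε : 0 < ε) : ∃ W : Finset V, W.Nonempty ∧
      ((edgeBoundary G (W : Set V)).ncard : ℝ) < ε * W.card := by
  obtain ⟨v⟩ := ‹Nonempty V›
  have : Nonempty {W : Finset V // W.Nonempty} := ⟨⟨{v}, Finset.singleton_nonempty v⟩⟩
  obtain ⟨W, hW⟩ := exists_lt_of_ciInf_lt (h.trans_lt hε)
  exact ⟨W.1, W.2, (div_lt_iff₀ (by exact_mod_cast W.2.card_pos)).1 hW⟩

/-- Følner sets, on which the boundary is small in proportion, are almost invariant under every
distance operator, which therefore attains its largest possible norm. -/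
theorem norm_neighborOperator_sphere_eq [Nonempty V]
    (hd : ∀ k, ∃ d, ∀ v, (sphere G hconn hlf k v).card = d)
    (h : isoperimetricConstant G = 0) {k d : ℕ} (hk : ∀ v, (sphere G hconn hlf k v).card = d) :
    ‖neighborOperator (sphere G hconn hlf k) d (mem_sphere_comm G hconn hlf k) hk‖ = d := by
  classical
  refine le_antisymm (norm_neighborOperator_le _ _) ?_
  obtain ⟨C, hC⟩ := exists_sum_card_sphere_sdiff_le G hconn hlf hd k
  refine le_of_forall_pos_le_add fun ε hε => ?_
  obtain ⟨W, hW, hWε⟩ := exists_ncard_edgeBoundary_lt G h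
    (show 0 < ε / (C + 1) by positivity)
  have h1 := mul_card_le_norm_neighborOperator (mem_sphere_comm G hconn hlf k) hk W
  have h2 : ∑ v ∈ W, ((sphere G hconn hlf k v \ W).card : ℝ) ≤ ε * W.card := by
    have hC' := hC W
    rw [← ncard_edgeBoundary] at hC'
    calc ∑ v ∈ W, ((sphere G hconn hlf k v \ W).card : ℝ)
        ≤ C * ((edgeBoundary G (W : Set V)).ncard : ℝ) := by exact_mod_cast hC'
      _ ≤ (C + 1) * (ε / (C + 1) * W.card) := by gcongr; linarith
      _ = ε * W.card := by field_simp
  have hW0 : (0 : ℝ) < W.card := by exact_mod_cast hW.card_pos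
  refine le_of_mul_le_mul_right ?_ hW0
  linarith

end

end DistanceGraph

end

open DistanceGraph

theorem mainTheorem2 {V : Type*} [Countable V] (G : SimpleGraph V) (hconn : G.Connected)
    (hlf : ∀ v : V, (G.neighborSet v).Finite) (hdr : DistanceGraph.IsDistanceRegular G) :
    ∃ (A : ℕ → DistanceGraph.ell2 V →L[ℂ] DistanceGraph.ell2 V) (deg : ℕ → ℕ),
      (∀ k : ℕ, DistanceGraph.distanceOperator G k = (A k).toLinearMap.toPMap ⊤) ∧
      (∀ k : ℕ, DistanceGraph.IsRegularAt G k (deg k)) ∧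
      (∀ k : ℕ, ‖A k‖ ≤ (deg k : ℝ)) ∧
      (DistanceGraph.isoperimetricConstant G = 0 ↔ ∀ k : ℕ, ‖A k‖ = (deg k : ℝ)) := by
  classical
  have : Nonempty V := hconn.nonempty
  have hex := exists_card_sphere G hconn hlf hdr
  choose deg hdeg using hex
  refine ⟨fun k => neighborOperator (sphere G hconn hlf k) (deg k)
    (mem_sphere_comm G hconn hlf k) (hdeg k), deg,
    fun k => distanceOperator_eq G hconn hlf (hdeg k), fun k v => ?_,
    fun k => norm_neighborOperator_le _ _, fun h k => ?_, fun h => ?_⟩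
  · rw [distanceVector_eq_sum G hconn hlf, norm_sum_delta_sq, hdeg]
  · exact norm_neighborOperator_sphere_eq G hconn hlf (fun k => ⟨deg k, hdeg k⟩) h (hdeg k)
  -- The adjacency operator alone already forces a vanishing isoperimetric constant.
  · by_contra hne
    refine (norm_neighborOperator_lt (mem_sphere_comm G hconn hlf 1) (hdeg 1)
      ((isoperimetricConstant_nonneg G).lt_of_ne' hne) fun W => ?_).ne (h 1)
    have hW := isoperimetricConstant_mul_card_le G W
    rw [ncard_edgeBoundary G hconn hlf] at hW
    exact_mod_cast hW
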